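/- Let $m,n\in\mathbb N$ and let $G:\mathbb R^n\to\mathbb C^{m\times m}$ be bounded and continuous. A function $F:\mathbb R^n\to\mathbb C$ is called positive semidefinite if for all $N\in\mathbb N$ and $x_1,\dots,x_N\in\mathbb R^n$ the matrix $(F(x_p-x_q))_{1\le p,q\le N}$ is positive semidefinite. For $p\in[1,\infty)$ equip $L^p(\mathbb R^n)^m$ (complex-valued functions, Lebesgue measure) with the norm $\|f\|=\sum_{j=1}^m\|f_j\|_{L^p(\mathbb R^n)}$, and let $L^p(\mathbb R^n)^m_+$ be the set of $f=(f_1,\dots,f_m)^\top\in L^p(\mathbb R^n)^m$ with $f_k\ge 0$ a.e. for all $k$. Put $$f^\wedge(y)=(2\pi)^{-n/2}\int_{\mathbb R^n}e^{-iy\cdot x}f(x)\,d^nx,\qquad g^\vee(x)=(2\pi)^{-n/2}\int_{\mathbb R^n}e^{ix\cdot y}g(y)\,d^ny .$$ Let $C_0^\infty(\mathbb R^n)$ be the space of smooth compactly supported complex-valued functions and $C_\infty(\mathbb R^n)$ the space of continuous complex-valued functions vanishing at infinity, and consider the linear operator $$G(-i\nabla)\big|_{C_0^\infty(\mathbb R^n)^m}:C_0^\infty(\mathbb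 R^n)^m\to C_\infty(\mathbb R^n)^m,\qquad (f_1,\dots,f_m)^\top\mapsto\Big(G\,(f_1^\wedge,\dots,f_m^\wedge)^\top\Big)^\vee. \tag{1}$$ Then the following are equivalent: (i) For all $1\le j,k\le m$, $G_{j,k}:\mathbb R^n\to\mathbb C$ is positive semidefinite. (ii) The operator (1) extends to a bounded linear operator $G(-i\nabla)$ on $L^1(\mathbb R^n)^m$ satisfying $G(-i\nabla)\big(L^1(\mathbb R^n)^m_+\big)\subseteq L^1(\mathbb R^n)^m_+$. (iii) There exists $p\in(1,\infty)$ such that the operator (1) extends to a bounded linear operator $G(-i\nabla)$ on $L^p(\mathbb R^n)^m$ satisfying $G(-i\nabla)\big(L^p(\mathbb R^n)^m_+\big)\subseteq L^p(\mathbb R^n)^m_+$. (iv) For all $p\in(1,\infty)$, the operator (1) extends to a bounded linear operator $G(-i\nabla)$ on $L^p(\mathbb R^n)^m$ satisfying $G(-i\nabla)\big(L^p(\mathbb R^n)^m_+\big)\subseteq L^p(\mathbb R^n)^m_+$. -/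

import Mathlib

open MeasureTheory Filter
open scoped ComplexOrder ENNReal FourierTransform Topology

noncomputable section

namespace PosMultiplier

/-- Euclidean space `ℝⁿ`. -/
abbrev Rn (n : ℕ) : Type := EuclideanSpace ℝ (Fin n)

/-- The space of smooth, compactly supported functions `ℝⁿ → ℂ`. -/
abbrev Test (n : ℕ) : Type :=
  TestFunction (⊤ : TopologicalSpace.Opens (Rn n)) ℂ (⊤ : ℕ∞)

/-- The space of continuous functions `ℝⁿ → ℂ` that vanish at infinity. -/
abbrev CInfty (n : ℕ) : Type := ZeroAtInftyContinuousMap (Rn n) ℂ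

/-- The space `L^p(ℝⁿ)^m` with the norm `‖f‖ = ∑ j, ‖f j‖_{L^p}`. -/
abbrev LpVec (n m : ℕ) (p : ℝ≥0∞) : Type :=
  PiLp 1 (fun _ : Fin m => Lp ℂ p (volume : Measure (Rn n)))

/-- A function `F : ℝⁿ → ℂ` is positive semidefinite if all the matrices `(F (x_p - x_q))_{p,q}`
are positive semidefinite. -/
def IsPosSemidefFun {n : ℕ} (F : Rn n → ℂ) : Prop :=
  ∀ (N : ℕ) (x : Fin N → Rn n),
    (Matrix.of fun p q : Fin N => F (x p - x q)).PosSemidef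

/-- The Fourier transform `f^∧(y) = (2π)^{-n/2} ∫ e^{-i y·x} f(x) dx`. -/
def hat {n : ℕ} (f : Rn n → ℂ) (y : Rn n) : ℂ :=
  (((2 * Real.pi) ^ (-(n : ℝ) / 2) : ℝ) : ℂ) *
    ∫ x, Complex.exp (-Complex.I * (inner ℝ y x : ℝ)) * f x

/-- The inverse Fourier transform `g^∨(x) = (2π)^{-n/2} ∫ e^{i x·y} g(y) dy`. -/
def check {n : ℕ} (g : Rn n → ℂ) (x : Rn n) : ℂ :=
  (((2 * Real.pi) ^ (-(n : ℝ) / 2) : ℝ) : ℂ) *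
    ∫ y, Complex.exp (Complex.I * (inner ℝ x y : ℝ)) * g y

lemma hat_eq {n : ℕ} (f : Rn n → ℂ) (y : Rn n) :
    hat f y = (((2 * Real.pi) ^ (-(n : ℝ) / 2) : ℝ) : ℂ) * 𝓕 f ((2 * Real.pi)⁻¹ • y) := by
  have h : (2 * Real.pi) ≠ 0 := by positivity
  rw [hat, Real.fourier_eq']
  congr 2
  ext x
  rw [smul_eq_mul, inner_smul_right, real_inner_comm y x]
  congr 2
  rw [show -2 * Real.pi * ((2 * Real.pi)⁻¹ * inner ℝ y x) = -inner ℝ y x by field_simp]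
  push_cast
  ring

lemma check_eq {n : ℕ} (g : Rn n → ℂ) (x : Rn n) : check g x = hat g (-x) := by
  simp [check, hat]

lemma hat_tendsto {n : ℕ} (f : Rn n → ℂ) : Tendsto (hat f) (cocompact (Rn n)) (𝓝 0) := by
  have h : (2 * Real.pi)⁻¹ ≠ 0 := by positivity
  have h1 : Tendsto (𝓕 f) (cocompact (Rn n)) (𝓝 0) :=
    tendsto_integral_exp_inner_smul_cocompact f
  have h2 : Tendsto (fun y : Rn n => (2 * Real.pi)⁻¹ • y) (cocompact _) (cocompact _) :=
    (Homeomorph.smulOfNeZero _ h).isClosedEmbedding.tendsto_cocompact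
  have h3 := (h1.comp h2).const_mul ((((2 * Real.pi) ^ (-(n : ℝ) / 2) : ℝ) : ℂ))
  rw [mul_zero] at h3
  refine h3.congr fun y => ?_
  rw [hat_eq]; rfl

lemma hat_continuous {n : ℕ} {f : Rn n → ℂ} (hf : Integrable f) : Continuous (hat f) := by
  have h1 : Continuous (𝓕 f) :=
    VectorFourier.fourierIntegral_continuous Real.continuous_fourierChar
      (by exact continuous_inner) hf
  have h2 : hat f = fun y => (((2 * Real.pi) ^ (-(n : ℝ) / 2) : ℝ) : ℂ) *
      𝓕 f ((2 * Real.pi)⁻¹ • y) := funext (hat_eq f)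
  rw [h2]
  fun_prop

lemma exp_mul_integrable {n : ℕ} {f : Rn n → ℂ} (hf : Integrable f) (y : Rn n) :
    Integrable fun x => Complex.exp (-Complex.I * (inner ℝ y x : ℝ)) * f x := by
  refine hf.bdd_mul (c := 1) (Continuous.aestronglyMeasurable (by fun_prop)) ?_
  refine Eventually.of_forall fun x => ?_
  rw [show -Complex.I * ((inner ℝ y x : ℝ) : ℂ) = ((-inner ℝ y x : ℝ) : ℂ) * Complex.I by
    push_cast; ring]
  exact (Complex.norm_exp_ofReal_mul_I _).le

lemma hat_add {n : ℕ} {f g : Rn n → ℂ} (hf : Integrable f) (hg : Integrable g) (y : Rn n) :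
    hat (fun x => f x + g x) y = hat f y + hat g y := by
  simp only [hat, mul_add]
  rw [integral_add (exp_mul_integrable hf y) (exp_mul_integrable hg y), mul_add]

lemma hat_smul {n : ℕ} (c : ℂ) (f : Rn n → ℂ) (y : Rn n) :
    hat (fun x => c * f x) y = c * hat f y := by
  simp only [hat]
  simp_rw [mul_left_comm _ c]
  rw [integral_const_mul, mul_left_comm]

lemma test_integrable {n : ℕ} (f : Test n) : Integrable (f : Rn n → ℂ) :=
  f.continuous.integrable_of_hasCompactSupport f.hasCompactSupport

lemma hat_test_integrable {n : ℕ} (f : Test n) : Integrable (hat (f : Rn n → ℂ)) := by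
  have h : (2 * Real.pi)⁻¹ ≠ 0 := by positivity
  have h1 : Integrable (𝓕 (f : Rn n → ℂ)) := by
    have := (𝓕 (f.hasCompactSupport.toSchwartzMap f.contDiff)).integrable (μ := volume)
    exact this
  have h2 := (h1.comp_smul h).const_mul ((((2 * Real.pi) ^ (-(n : ℝ) / 2) : ℝ) : ℂ))
  exact h2.congr (Eventually.of_forall fun y => (hat_eq _ y).symm)

variable {n m : ℕ}

/-- The `j`-th component of `G (f_1^∧, …, f_m^∧)ᵀ`. -/
def symbolMul (G : Rn n → Matrix (Fin m) (Fin m) ℂ) (f : Fin m → Test n) (j : Fin m)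
    (y : Rn n) : ℂ :=
  (G y).mulVec (fun k => hat (f k) y) j

lemma symbolMul_integrable {G : Rn n → Matrix (Fin m) (Fin m) ℂ} (hc : Continuous G)
    (hb : ∃ C : ℝ, ∀ x j k, ‖G x j k‖ ≤ C) (f : Fin m → Test n) (j : Fin m) :
    Integrable (symbolMul G f j) := by
  obtain ⟨C, hC⟩ := hb
  have : symbolMul G f j = fun y => ∑ k, G y j k * hat (f k) y := by
    ext y; simp [symbolMul, Matrix.mulVec, dotProduct]
  rw [this]
  refine integrable_finsetSum _ fun k _ => ?_
  refine (hat_test_integrable (f k)).bdd_mul (c := C)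
    (Continuous.aestronglyMeasurable (hc.matrix_elem j k)) ?_
  exact Eventually.of_forall fun x => hC x j k

/-- The linear operator `G(-i∇)` on `C_0^∞(ℝⁿ)^m`, with values in `C_∞(ℝⁿ)^m`,
`(f_1, …, f_m)ᵀ ↦ (G (f_1^∧, …, f_m^∧)ᵀ)^∨`. -/
def multiplier (G : Rn n → Matrix (Fin m) (Fin m) ℂ) (hc : Continuous G)
    (hb : ∃ C : ℝ, ∀ x j k, ‖G x j k‖ ≤ C) : (Fin m → Test n) →ₗ[ℂ] (Fin m → CInfty n) where
  toFun f j :=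
    { toFun := check (symbolMul G f j)
      continuous_toFun := by
        have h : check (symbolMul G f j) = fun x => hat (symbolMul G f j) (-x) :=
          funext (check_eq _)
        rw [h]
        exact (hat_continuous (symbolMul_integrable hc hb f j)).comp continuous_neg
      zero_at_infty' := by
        have h : check (symbolMul G f j) = fun x => hat (symbolMul G f j) (-x) :=
          funext (check_eq _)
        change Tendsto (check (symbolMul G f j)) _ _
        rw [h]
        exact (hat_tendsto (symbolMul G f j)).comp
          (Homeomorph.neg (Rn n)).isClosedEmbedding.tendsto_cocompact }
  map_add' f g := by
    ext j x
    change check (symbolMul G (f + g) j) x = check (symbolMul G f j) x + check (symbolMul G g j) x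
    have h : symbolMul G (f + g) j = fun y => symbolMul G f j y + symbolMul G g j y := by
      ext y
      have h0 : ∀ k, hat ((f + g) k : Test n) y = hat (f k) y + hat (g k) y := fun k =>
        hat_add (test_integrable (f k)) (test_integrable (g k)) y
      simp [symbolMul, Matrix.mulVec, dotProduct, h0, mul_add, Finset.sum_add_distrib,
        -Pi.add_apply]
    rw [h, check_eq, check_eq, check_eq,
      hat_add (symbolMul_integrable hc hb f j) (symbolMul_integrable hc hb g j)]
  map_smul' c f := by
    ext j x
    change check (symbolMul G (c • f) j) x = c * check (symbolMul G f j) x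
    have h : symbolMul G (c • f) j = fun y => c * symbolMul G f j y := by
      ext y
      have h0 : ∀ k, hat ((c • f) k : Test n) y = c * hat (f k) y := fun k =>
        hat_smul c (f k) y
      simp [symbolMul, Matrix.mulVec, dotProduct, h0, Finset.mul_sum, mul_left_comm,
        -Pi.smul_apply]
    rw [h, check_eq, check_eq, hat_smul]

/-- The inclusion of `C_0^∞(ℝⁿ)^m` into `L^p(ℝⁿ)^m`. -/
def testToLp (p : ℝ≥0∞) (f : Fin m → Test n) : LpVec n m p :=
  WithLp.toLp 1 fun k =>
    ((f k).continuous.memLp_of_hasCompactSupport (f k).hasCompactSupport).toLp (f k)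

/-- Membership in the cone `L^p(ℝⁿ)_+^m`: every component is (real and) nonnegative a.e. -/
def IsNonneg {p : ℝ≥0∞} (u : LpVec n m p) : Prop :=
  ∀ k, ∀ᵐ x, 0 ≤ (u k : Rn n → ℂ) x

/-- The operator `A` from `C_0^∞(ℝⁿ)^m` to `C_∞(ℝⁿ)^m` extends boundedly to an operator in
`B(L^p(ℝⁿ)^m)` that maps `L^p(ℝⁿ)_+^m` into itself. -/
def ExtendsToPositive (A : (Fin m → Test n) →ₗ[ℂ] (Fin m → CInfty n)) (p : ℝ≥0∞)
    [Fact (1 ≤ p)] : Prop :=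
  ∃ T : LpVec n m p →L[ℂ] LpVec n m p,
    (∀ (f : Fin m → Test n) (j : Fin m), (T (testToLp p f) j : Rn n → ℂ) =ᵐ[volume] A f j) ∧
    ∀ u : LpVec n m p, IsNonneg u → IsNonneg (T u)

end PosMultiplier

end

/-!
The operator acts on the components of `f` through the scalar multipliers `f_k ↦ (G_{jk} f_k^∧)^∨`,
and both positivity and boundedness reduce to these. Morally, `G_{jk}` is positive semidefinite if
and only if its multiplier is convolution with a finite positive measure (Bochner's theorem). The
measure is avoided here by damping with Gaussians.

Sufficiency. If `g` is bounded, continuous and positive semidefinite, then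
`K_ε = 𝓕⁻ (exp (-ε ‖·‖²) g)` is nonnegative (`IsPosSemidefFun.fourierInv_gaussian_mul_nonneg`), and
therefore has `∫ K_ε ≤ ‖g 0‖` (`lintegral_enorm_fourierInv_le`). The damped multiplier is
convolution with `K_ε`; it preserves nonnegative functions and is bounded on every `L^p` by `‖g 0‖`,
uniformly in `ε` (`eLpNorm_integral_mul_sub_le`). Letting `ε → 0` gives both properties for the
multiplier on test functions. Since test functions are dense in `L^p`, and nonnegative ones in
its positive cone (`exists_test_tendsto_eLpNorm_sub`), they persist for the extension to
`L^p`, for every `p < ∞`.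

Necessity. Only positivity on test functions is used, for whichever `p`. For a test function `φ ≥ 0`
the function `F = G_{jk} 𝓕 φ` (in the normalization of Mathlib) is continuous and integrable with
`𝓕⁻ F ≥ 0`. Gaussian summation of the inversion formula exhibits `F` as a pointwise limit of Fourier
transforms of nonnegative integrable functions, hence as a positive semidefinite function
(`isPosSemidefFun_of_fourierInv_nonneg`). As `φ` runs through an approximate identity, `𝓕 φ → 1`
pointwise, and `G_{jk}` is positive semidefinite as a limit.
-/

namespace PosMultiplier

open Complex

/-! ### Positive semidefinite functions and the Fourier transform -/

lemma integrable_gaussian {n : ℕ} {a : ℝ} (ha : 0 < a) :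
    Integrable (fun x : Rn n => Real.exp (-a * ‖x‖ ^ 2)) := by
  have := (GaussianFourier.integrable_cexp_neg_mul_sq_norm_add (V := Rn n) (b := (a : ℂ))
    (by simpa using ha) 0 0).norm
  refine this.congr (Eventually.of_forall fun x => ?_)
  simp only [Complex.norm_exp]
  congr 1
  simp [← Complex.ofReal_pow]

lemma IsPosSemidefFun.sum_nonneg {n : ℕ} {g : Rn n → ℂ} (hg : IsPosSemidefFun g) {N : ℕ}
    (x : Fin N → Rn n) (c : Fin N → ℂ) :
    0 ≤ ∑ p, ∑ q, star (c p) * g (x p - x q) * c q := by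
  have := (hg N x).dotProduct_mulVec_nonneg c
  simpa [dotProduct, Matrix.mulVec, Finset.mul_sum, mul_assoc] using this

/-- Integrated form of positive semidefiniteness. With `N` independent samples `x₁, …, x_N` from
`ν`, the quadratic form `∑ p q, star (c x_p) * g (x_p - x_q) * c x_q` is nonnegative; its
expectation is `N * A + N * (N - 1) * B`, where `A` is the diagonal contribution and `B` the
integral in question. Dividing by `N²` and letting `N → ∞` leaves `B`. -/
lemma IsPosSemidefFun.integral_prod_nonneg {n : ℕ} {g : Rn n → ℂ} (hg : IsPosSemidefFun g)
    (hgc : Continuous g) {C : ℝ} (hgC : ∀ x, ‖g x‖ ≤ C) (ν : Measure (Rn n))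
    [IsProbabilityMeasure ν] {c : Rn n → ℂ} (hc : Continuous c) (hc1 : ∀ x, ‖c x‖ ≤ 1) :
    0 ≤ ∫ z, star (c z.1) * g (z.1 - z.2) * c z.2 ∂(ν.prod ν) := by
  set k : Rn n × Rn n → ℂ := fun z => star (c z.1) * g (z.1 - z.2) * c z.2 with hk
  have hkc : Continuous k := by fun_prop
  have hkC : ∀ z, ‖k z‖ ≤ C := fun z => by
    have h0 : 0 ≤ C := (norm_nonneg _).trans (hgC 0)
    simp only [hk, norm_mul, norm_star]
    calc ‖c z.1‖ * ‖g (z.1 - z.2)‖ * ‖c z.2‖ ≤ 1 * C * 1 := by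
          gcongr
          exacts [hc1 _, hgC _, hc1 _]
      _ = C := by ring
  set A : ℂ := ∫ x, k (x, x) ∂ν
  set B : ℂ := ∫ z, k z ∂(ν.prod ν)
  have key : ∀ N : ℕ, (0 : ℂ) ≤ N * A + N * (N - 1) * B := by
    intro N
    let P : Measure (Fin N → Rn n) := Measure.pi fun _ => ν
    have hint : ∀ p q : Fin N, Integrable (fun x : Fin N → Rn n => k (x p, x q)) P := fun p q =>
      Integrable.of_bound (Continuous.aestronglyMeasurable (by fun_prop)) C
        (Eventually.of_forall fun x => hkC _)
    have hdiag : ∀ p : Fin N, ∫ x, k (x p, x p) ∂P = A := fun p => by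
      have h := (measurePreserving_eval (fun _ : Fin N => ν) p)
      have hm : AEStronglyMeasurable (fun x => k (x, x)) (Measure.map (Function.eval p) P) :=
        Continuous.aestronglyMeasurable (by fun_prop)
      have h1 := integral_map h.measurable.aemeasurable hm
      rw [h.map_eq] at h1
      exact h1.symm
    have hoff : ∀ p q : Fin N, p ≠ q → ∫ x, k (x p, x q) ∂P = B := fun p q hpq => by
      have hind : ProbabilityTheory.IndepFun (fun x : Fin N → Rn n => x p) (fun x => x q) P :=
        (ProbabilityTheory.iIndepFun_pi (μ := fun _ : Fin N => ν)
          (X := fun _ x => x) fun _ => aemeasurable_id).indepFun hpq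
      have h2 := (ProbabilityTheory.indepFun_iff_map_prod_eq_prod_map_map
        (measurable_pi_apply p).aemeasurable (measurable_pi_apply q).aemeasurable).1 hind
      have hp : Measure.map (fun x : Fin N → Rn n => x p) P = ν :=
        (measurePreserving_eval (fun _ : Fin N => ν) p).map_eq
      have hq : Measure.map (fun x : Fin N → Rn n => x q) P = ν :=
        (measurePreserving_eval (fun _ : Fin N => ν) q).map_eq
      rw [hp, hq] at h2
      have hm : AEStronglyMeasurable k
          (Measure.map (fun x : Fin N → Rn n => (x p, x q)) P) := hkc.aestronglyMeasurable
      have hF : Measurable fun x : Fin N → Rn n => (x p, x q) := by fun_prop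
      have h3 := integral_map hF.aemeasurable hm
      rw [h2] at h3
      exact h3.symm
    have hsum : ∫ x, ∑ p, ∑ q, k (x p, x q) ∂P = N * A + N * (N - 1) * B := by
      rw [integral_finsetSum _ fun p _ => integrable_finsetSum _ fun q _ => hint p q]
      simp_rw [integral_finsetSum _ fun q _ => hint _ q]
      have : ∀ p q : Fin N, ∫ x, k (x p, x q) ∂P = B + if p = q then A - B else 0 := by
        intro p q
        split_ifs with h
        · subst h; rw [hdiag]; ring
        · rw [hoff p q h, add_zero]
      simp_rw [this]
      simp [Finset.sum_add_distrib]
      ring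
    rw [← hsum]
    exact integral_nonneg fun x => hg.sum_nonneg x fun p => c (x p)
  have hlim : Tendsto (fun N : ℕ => (((N : ℝ)⁻¹ : ℝ) : ℂ) * A + (1 - (((N : ℝ)⁻¹ : ℝ) : ℂ)) * B)
      atTop (𝓝 B) := by
    have h0 : Tendsto (fun N : ℕ => (((N : ℝ)⁻¹ : ℝ) : ℂ)) atTop (𝓝 0) := by
      rw [← Complex.ofReal_zero]
      exact (Complex.continuous_ofReal.tendsto 0).comp
        (tendsto_inv_atTop_zero.comp tendsto_natCast_atTop_atTop)
    have h1 := (h0.mul_const A).add (((tendsto_const_nhds (x := (1 : ℂ))).sub h0).mul_const B)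
    rwa [zero_mul, sub_zero, one_mul, zero_add] at h1
  refine ge_of_tendsto hlim ?_
  filter_upwards [eventually_gt_atTop 0] with N hN
  have h1 := key N
  have hN' : (N : ℂ) ≠ 0 := by exact_mod_cast hN.ne'
  have h2 : (0 : ℂ) ≤ ((((N : ℝ)⁻¹ ^ 2 : ℝ)) : ℂ) := by
    exact_mod_cast (by positivity : (0 : ℝ) ≤ (N : ℝ)⁻¹ ^ 2)
  have h3 := mul_nonneg h2 h1
  convert h3 using 1
  push_cast
  field_simp

/-- Damping a bounded continuous positive semidefinite function by a Gaussian makes its inverse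
Fourier transform nonnegative: up to a positive constant, the latter is the double integral of
`IsPosSemidefFun.integral_prod_nonneg` for a Gaussian measure and a character `c`. -/
lemma IsPosSemidefFun.fourierInv_gaussian_mul_nonneg {n : ℕ} {g : Rn n → ℂ}
    (hg : IsPosSemidefFun g) (hgc : Continuous g) {C : ℝ} (hgC : ∀ x, ‖g x‖ ≤ C) {ε : ℝ}
    (hε : 0 < ε) (ξ : Rn n) :
    0 ≤ 𝓕⁻ (fun x : Rn n => (Real.exp (-ε * ‖x‖ ^ 2) : ℂ) * g x) ξ := by
  have hC0 : 0 ≤ C := (norm_nonneg _).trans (hgC 0)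
  set ρ : Rn n → ℝ := fun x => Real.exp (-(2 * ε) * ‖x‖ ^ 2) with hρ
  have hρc : Continuous ρ := by fun_prop
  have hρi : Integrable ρ := integrable_gaussian (by positivity)
  have hρpos : ∀ x, 0 < ρ x := fun x => Real.exp_pos _
  set Z : ℝ := ∫ x, ρ x
  have hZ : 0 < Z := integral_exp_pos hρi
  -- the Gaussian `ρ` has exponent `2 * ε` so that `ρ (u + y) * ρ y` carries the factor
  -- `exp (-ε * ‖u‖ ^ 2)`
  set ν : Measure (Rn n) := volume.withDensity fun x => ENNReal.ofReal (Z⁻¹ * ρ x) with hν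
  have hνp : IsProbabilityMeasure ν := by
    constructor
    rw [hν, withDensity_apply _ MeasurableSet.univ, Measure.restrict_univ,
      ← ofReal_integral_eq_lintegral_ofReal (hρi.const_mul _)
        (Eventually.of_forall fun x => by have := hρpos x; positivity), integral_const_mul,
      inv_mul_cancel₀ hZ.ne', ENNReal.ofReal_one]
  set c : Rn n → ℂ := fun x => cexp (↑(-2 * Real.pi * inner ℝ x ξ) * I) with hcdef
  have hcc : Continuous c := by fun_prop
  have h0 := hg.integral_prod_nonneg hgc hgC ν hcc
    (fun x => (Complex.norm_exp_ofReal_mul_I _).le)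
  set e : Rn n → ℂ := fun u => cexp (↑(2 * Real.pi * inner ℝ u ξ) * I) with he
  have hec : Continuous e := by fun_prop
  have hcorr : ∀ x y, star (c x) * g (x - y) * c y = e (x - y) * g (x - y) := by
    intro x y
    have : star (c x) * c y = e (x - y) := by
      simp only [hcdef, he, Complex.star_def, ← Complex.exp_conj, ← Complex.exp_add]
      congr 1
      simp only [map_mul, Complex.conj_ofReal, Complex.conj_I, inner_sub_left]
      push_cast
      ring
    rw [← this]; ring
  have hwd : ∀ f : Rn n → ℂ, ∫ x, f x ∂ν = ∫ x, ((Z⁻¹ * ρ x : ℝ) : ℂ) * f x := by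
    intro f
    rw [hν, integral_withDensity_eq_integral_toReal_smul (by fun_prop)
      (Eventually.of_forall fun x => ENNReal.ofReal_lt_top)]
    refine integral_congr_ae (Eventually.of_forall fun x => ?_)
    have := hρpos x
    simp only [Complex.real_smul]
    rw [ENNReal.toReal_ofReal (by positivity)]
  set M : ℝ := ∫ y : Rn n, Real.exp (-(4 * ε) * ‖y‖ ^ 2)
  have hM : 0 < M := integral_exp_pos (integrable_gaussian (by positivity))
  have hpar : ∀ u y : Rn n, ρ (u + y) * ρ y =
      Real.exp (-ε * ‖u‖ ^ 2) * Real.exp (-(4 * ε) * ‖y + (2⁻¹ : ℝ) • u‖ ^ 2) := by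
    intro u y
    simp only [hρ, ← Real.exp_add]
    congr 1
    have h1 := @norm_add_sq_real _ _ _ u y
    have h2 := @norm_add_sq_real _ _ _ y ((2⁻¹ : ℝ) • u)
    rw [norm_smul, inner_smul_right, real_inner_comm] at h2
    rw [h1, h2]
    norm_num
    ring
  have hint : Integrable (fun z : Rn n × Rn n =>
      ((ρ (z.1 + z.2) * ρ z.2 : ℝ) : ℂ) * (e z.1 * g z.1)) (volume.prod volume) := by
    have hdom := ((integrable_gaussian (n := n) (half_pos hε)).mul_prod
      (integrable_gaussian (n := n) hε)).mul_const C
    refine hdom.mono' (Continuous.aestronglyMeasurable (by fun_prop))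
      (Eventually.of_forall fun z => ?_)
    rw [norm_mul, norm_mul, Complex.norm_exp_ofReal_mul_I, one_mul, Complex.norm_real,
      Real.norm_of_nonneg (mul_pos (hρpos _) (hρpos _)).le]
    gcongr ?_ * ?_
    · simp only [hρ, ← Real.exp_add]
      refine Real.exp_le_exp.2 ?_
      have h1 := parallelogram_law_with_norm ℝ (z.1 + z.2) z.2
      rw [add_sub_cancel_right] at h1
      have h2 : ‖z.1‖ ^ 2 ≤ 2 * (‖z.1 + z.2‖ ^ 2 + ‖z.2‖ ^ 2) := by
        rw [← h1]; exact le_add_of_nonneg_left (sq_nonneg _)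
      have h3 := mul_le_mul_of_nonneg_left h2 hε.le
      have h4 := mul_nonneg hε.le (sq_nonneg ‖z.1 + z.2‖)
      have h5 := mul_nonneg hε.le (sq_nonneg ‖z.2‖)
      linarith
    · exact hgC _
  have hfin : ∫ z, star (c z.1) * g (z.1 - z.2) * c z.2 ∂(ν.prod ν) =
      ((Z⁻¹ ^ 2 * M : ℝ) : ℂ) *
        𝓕⁻ (fun x : Rn n => (Real.exp (-ε * ‖x‖ ^ 2) : ℂ) * g x) ξ := by
    rw [integral_prod_symm _ (Integrable.of_bound
      (Continuous.aestronglyMeasurable (by fun_prop)) C (Eventually.of_forall fun z => ?_))]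
    · simp_rw [hcorr, hwd]
      calc ∫ y, ((Z⁻¹ * ρ y : ℝ) : ℂ) * ∫ x, ((Z⁻¹ * ρ x : ℝ) : ℂ) * (e (x - y) * g (x - y))
          = ∫ y, ∫ u, ((Z⁻¹ ^ 2 : ℝ) : ℂ) * (((ρ (u + y) * ρ y : ℝ) : ℂ) * (e u * g u)) := by
            congr 1; ext y
            rw [← integral_add_right_eq_self _ y, ← integral_const_mul]
            congr 1; ext u
            simp only [add_sub_cancel_right]
            push_cast; ring
        _ = ((Z⁻¹ ^ 2 : ℝ) : ℂ) * ∫ u, ∫ y, ((ρ (u + y) * ρ y : ℝ) : ℂ) * (e u * g u) := by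
            simp_rw [integral_const_mul]
            congr 1
            exact integral_integral_swap (f := fun y u =>
              ((ρ (u + y) * ρ y : ℝ) : ℂ) * (e u * g u)) hint.swap
        _ = _ := by
            have : ∀ u, ∫ y, ((ρ (u + y) * ρ y : ℝ) : ℂ) * (e u * g u) =
                (M : ℂ) * (e u * ((Real.exp (-ε * ‖u‖ ^ 2) : ℂ) * g u)) := by
              intro u
              rw [integral_mul_const, integral_complex_ofReal]
              simp_rw [hpar]
              rw [integral_const_mul, integral_add_right_eq_self
                (fun y : Rn n => Real.exp (-(4 * ε) * ‖y‖ ^ 2)) ((2⁻¹ : ℝ) • u)]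
              push_cast; ring
            simp_rw [this]
            rw [integral_const_mul, Real.fourierInv_eq']
            simp only [smul_eq_mul, he]
            push_cast; ring
    · rw [hcorr, norm_mul, Complex.norm_exp_ofReal_mul_I, one_mul]
      exact hgC _
  rw [hfin] at h0
  have hpos : (0 : ℝ) < Z⁻¹ ^ 2 * M := by positivity
  have h1 : (0 : ℂ) ≤ (((Z⁻¹ ^ 2 * M)⁻¹ : ℝ) : ℂ) := by exact_mod_cast (inv_pos.2 hpos).le
  have h2 := mul_nonneg h1 h0
  rwa [← mul_assoc, ← Complex.ofReal_mul, inv_mul_cancel₀ hpos.ne', Complex.ofReal_one,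
    one_mul] at h2

/-! ### Fourier inversion with Gaussian summation -/

lemma continuous_fourierInv {n : ℕ} {F : Rn n → ℂ} (hF : Integrable F) : Continuous (𝓕⁻ F) := by
  have h1 : Continuous (𝓕 F) :=
    VectorFourier.fourierIntegral_continuous Real.continuous_fourierChar
      (by exact continuous_inner) hF
  have h2 : 𝓕⁻ F = fun x => 𝓕 F (-x) := funext (Real.fourierInv_eq_fourier_neg F)
  rw [h2]
  fun_prop

lemma norm_fourierInv_le {n : ℕ} (F : Rn n → ℂ) (x : Rn n) : ‖𝓕⁻ F x‖ ≤ ∫ y, ‖F y‖ := by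
  rw [Real.fourierInv_eq']
  refine (norm_integral_le_integral_norm _).trans_eq ?_
  congr 1; ext y
  rw [norm_smul, Complex.norm_exp_ofReal_mul_I, one_mul]

lemma integrable_gaussian_mul {n : ℕ} {a : ℝ} (ha : 0 < a) {h : Rn n → ℂ}
    (hh : AEStronglyMeasurable h) {C : ℝ} (hC : ∀ x, ‖h x‖ ≤ C) :
    Integrable fun x => (Real.exp (-a * ‖x‖ ^ 2) : ℂ) * h x := by
  refine (integrable_gaussian ha).ofReal.mul_bdd (c := C) hh (Eventually.of_forall hC)

/-- Fourier inversion in the sense of Gaussian summability, without integrability of `𝓕⁻ F`. -/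
lemma tendsto_fourier_gaussian_mul_fourierInv {n : ℕ} {F : Rn n → ℂ} (hF : Integrable F) {v : Rn n}
    (hv : ContinuousAt F v) :
    Tendsto (fun c : ℝ => 𝓕 (fun w : Rn n => (Real.exp (-c⁻¹ * ‖w‖ ^ 2) : ℂ) * 𝓕⁻ F w) v) atTop
      (𝓝 (F v)) := by
  refine (Real.tendsto_integral_gaussian_smul' hF hv).congr' ?_
  filter_upwards [Ioi_mem_atTop 0] with c (hc : 0 < c)
  have J : Integrable (fun w : Rn n => cexp (-c⁻¹ * ‖w‖ ^ 2 + 2 * Real.pi * I * inner ℝ v w)) :=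
    GaussianFourier.integrable_cexp_neg_mul_sq_norm_add (by simpa) _ _
  have h1 : ∫ w, 𝓕 (fun w : Rn n => cexp (-c⁻¹ * ‖w‖ ^ 2 + 2 * Real.pi * I * inner ℝ v w)) w • F w =
      ∫ w, cexp (-c⁻¹ * ‖w‖ ^ 2 + 2 * Real.pi * I * inner ℝ v w) • 𝓕 F w := by
    simpa using! (VectorFourier.integral_fourierIntegral_smul_eq_flip (L := innerₗ (Rn n))
      Real.continuous_fourierChar continuous_inner J hF)
  have h2 : ∀ w : Rn n, 𝓕 (fun w : Rn n => cexp (-c⁻¹ * ‖w‖ ^ 2 +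
      2 * Real.pi * I * inner ℝ v w)) w = (Real.pi * c : ℂ) ^ (Module.finrank ℝ (Rn n) / 2 : ℂ) *
        cexp (-Real.pi ^ 2 * c * ‖v - w‖ ^ 2) := by
    intro w
    rw [fourier_gaussian_innerProductSpace' (by simpa)]
    congr
    · simp
    · simp; ring
  simp_rw [h2] at h1
  rw [h1, Real.fourier_eq', ← integral_neg_eq_self]
  refine integral_congr_ae (Eventually.of_forall fun w => ?_)
  simp only [smul_eq_mul, Real.fourierInv_eq_fourier_neg, norm_neg, inner_neg_right,
    real_inner_comm v w]
  rw [← mul_assoc]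
  congr 1
  rw [Complex.ofReal_exp, ← Complex.exp_add]
  congr 1
  push_cast
  ring

/-- If an integrable function has a nonnegative inverse Fourier transform, then the latter is
automatically integrable: its total mass is the Gaussian sum of the inversion formula at `0`. -/
lemma lintegral_enorm_fourierInv_le {n : ℕ} {F : Rn n → ℂ} (hF : Integrable F)
    (hc : ContinuousAt F 0) (hpos : ∀ x, 0 ≤ 𝓕⁻ F x) : ∫⁻ x, ‖𝓕⁻ F x‖ₑ ≤ ‖F 0‖ₑ := by
  have hcont := continuous_fourierInv hF
  set k : ℕ → Rn n → ℂ := fun N w => (Real.exp (-((N : ℝ) + 1)⁻¹ * ‖w‖ ^ 2) : ℂ) * 𝓕⁻ F w with hk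
  have hki : ∀ N, Integrable (k N) := fun N =>
    integrable_gaussian_mul (by positivity) hcont.aestronglyMeasurable (norm_fourierInv_le F)
  have hkpos : ∀ N w, 0 ≤ k N w := fun N w =>
    mul_nonneg (by exact_mod_cast (Real.exp_pos _).le) (hpos w)
  have hatTop : Tendsto (fun N : ℕ => (N : ℝ) + 1) atTop atTop :=
    tendsto_atTop_add_const_right _ _ tendsto_natCast_atTop_atTop
  have hnorm : ∀ N, eLpNorm (k N) 1 volume = ‖𝓕 (k N) 0‖ₑ := by
    intro N
    have h1 : 𝓕 (k N) 0 = ((∫ w, ‖k N w‖ : ℝ) : ℂ) := by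
      rw [Real.fourier_eq', ← integral_complex_ofReal]
      refine integral_congr_ae (Eventually.of_forall fun w => ?_)
      simp [Complex.norm_of_nonneg' (hkpos N w)]
    rw [h1, eLpNorm_one_eq_lintegral_enorm, ← ofReal_integral_norm_eq_lintegral_enorm (hki N),
      ← ofReal_norm, Complex.norm_real,
      Real.norm_of_nonneg (integral_nonneg fun _ => norm_nonneg _)]
  have hlim : ∀ w, Tendsto (fun N => k N w) atTop (𝓝 (𝓕⁻ F w)) := by
    intro w
    have h1 : Tendsto (fun N : ℕ => Real.exp (-((N : ℝ) + 1)⁻¹ * ‖w‖ ^ 2)) atTop (𝓝 1) := by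
      have := ((tendsto_inv_atTop_zero.comp hatTop).neg.mul_const (‖w‖ ^ 2))
      rw [neg_zero, zero_mul] at this
      simpa using! (Real.continuous_exp.tendsto 0).comp this
    have h2 := ((Complex.continuous_ofReal.tendsto 1).comp h1).mul_const (𝓕⁻ F w)
    rwa [Complex.ofReal_one, one_mul] at h2
  have h2 := Lp.eLpNorm_lim_le_liminf_eLpNorm (p := 1) (μ := volume)
    (fun N => (hki N).aestronglyMeasurable) (𝓕⁻ F) (Eventually.of_forall hlim)
  rw [eLpNorm_one_eq_lintegral_enorm] at h2
  refine h2.trans_eq ?_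
  simp_rw [hnorm]
  exact (((tendsto_fourier_gaussian_mul_fourierInv hF hc).comp hatTop).enorm).liminf_eq

lemma isPosSemidefFun_of_tendsto {n : ℕ} {ι : Type*} {l : Filter ι} [l.NeBot]
    {F : ι → Rn n → ℂ} {G : Rn n → ℂ} (hF : ∀ᶠ i in l, IsPosSemidefFun (F i))
    (hlim : ∀ x, Tendsto (fun i => F i x) l (𝓝 (G x))) : IsPosSemidefFun G := by
  intro N x
  refine Matrix.PosSemidef.of_dotProduct_mulVec_nonneg ?_ fun c => ?_
  · ext p q
    have h1 : Tendsto (fun i => star (F i (x q - x p))) l (𝓝 (star (G (x q - x p)))) :=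
      (hlim _).star
    refine tendsto_nhds_unique (h1.congr' ?_) (hlim (x p - x q))
    filter_upwards [hF] with i hi
    exact congrFun (congrFun (hi N x).1 p) q
  · have h1 : Tendsto (fun i => star c ⬝ᵥ (Matrix.of fun p q => F i (x p - x q)).mulVec c) l
        (𝓝 (star c ⬝ᵥ (Matrix.of fun p q => G (x p - x q)).mulVec c)) := by
      simp only [dotProduct, Matrix.mulVec, Matrix.of_apply]
      exact tendsto_finsetSum _ fun p _ => tendsto_const_nhds.mul
        (tendsto_finsetSum _ fun q _ => (hlim _).mul_const _)
    refine ge_of_tendsto h1 ?_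
    filter_upwards [hF] with i hi
    exact (hi N x).dotProduct_mulVec_nonneg c

/-- The easy direction of Bochner's theorem, for measures with a density. -/
lemma isPosSemidefFun_fourier {n : ℕ} {h : Rn n → ℂ} (hi : Integrable h) (hpos : ∀ x, 0 ≤ h x) :
    IsPosSemidefFun (𝓕 h) := by
  intro N x
  have hexp : ∀ (y : Rn n), Integrable fun w => cexp (↑(-2 * Real.pi * inner ℝ w y) * I) * h w :=
    fun y => hi.bdd_mul (c := 1) (Continuous.aestronglyMeasurable (by fun_prop))
      (Eventually.of_forall fun w => (Complex.norm_exp_ofReal_mul_I _).le)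
  refine Matrix.PosSemidef.of_dotProduct_mulVec_nonneg ?_ fun c => ?_
  · ext p q
    simp only [Matrix.conjTranspose_apply, Matrix.of_apply, Real.fourier_eq', Complex.star_def]
    rw [← integral_conj]
    congr 1; ext w
    have h0 : (starRingEnd ℂ) (h w) = h w :=
      Complex.conj_eq_iff_im.2 (Complex.nonneg_iff.1 (hpos w)).2.symm
    rw [smul_eq_mul, smul_eq_mul, map_mul, h0, ← Complex.exp_conj]
    congr 2
    rw [map_mul, Complex.conj_ofReal, Complex.conj_I, ← neg_sub (x p) (x q), inner_neg_right]
    push_cast; ring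
  · set s : Rn n → ℂ := fun w => ∑ q, c q * cexp (↑(2 * Real.pi * inner ℝ w (x q)) * I) with hs
    have h1 : star c ⬝ᵥ (Matrix.of fun p q => 𝓕 h (x p - x q)).mulVec c =
        ∫ w, star (s w) * s w * h w := by
      have h2 : ∀ w, star (s w) * s w * h w = ∑ p, ∑ q, star (c p) * c q *
          (cexp (↑(-2 * Real.pi * inner ℝ w (x p - x q)) * I) * h w) := by
        intro w
        rw [hs, star_sum, Finset.sum_mul_sum, Finset.sum_mul]
        refine Finset.sum_congr rfl fun p _ => ?_
        rw [Finset.sum_mul]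
        refine Finset.sum_congr rfl fun q _ => ?_
        have h3 : star (cexp (↑(2 * Real.pi * inner ℝ w (x p)) * I)) *
            cexp (↑(2 * Real.pi * inner ℝ w (x q)) * I) =
            cexp (↑(-2 * Real.pi * inner ℝ w (x p - x q)) * I) := by
          rw [Complex.star_def, ← Complex.exp_conj, ← Complex.exp_add]
          congr 1
          simp only [map_mul, Complex.conj_ofReal, Complex.conj_I, inner_sub_right]
          push_cast; ring
        rw [star_mul', ← h3]; ring
      simp_rw [h2]
      rw [integral_finsetSum _ fun p _ => integrable_finsetSum _ fun q _ =>
        (hexp _).const_mul _]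
      simp_rw [integral_finsetSum _ fun q _ => (hexp _).const_mul _, integral_const_mul]
      simp only [dotProduct, Matrix.mulVec, Matrix.of_apply, Pi.star_apply, Finset.mul_sum,
        Real.fourier_eq', smul_eq_mul]
      refine Finset.sum_congr rfl fun p _ => Finset.sum_congr rfl fun q _ => ?_
      ring
    rw [h1]
    exact integral_nonneg fun w => mul_nonneg (star_mul_self_nonneg _) (hpos w)

/-- `𝓕⁻ F` need not be known to be integrable: the Fourier transforms of its products with Gaussians
are positive semidefinite and converge to `F`. -/
lemma isPosSemidefFun_of_fourierInv_nonneg {n : ℕ} {F : Rn n → ℂ} (hF : Integrable F)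
    (hc : Continuous F) (hpos : ∀ x, 0 ≤ 𝓕⁻ F x) : IsPosSemidefFun F := by
  refine isPosSemidefFun_of_tendsto (l := atTop) ?_
    fun x => tendsto_fourier_gaussian_mul_fourierInv hF hc.continuousAt
  filter_upwards [Ioi_mem_atTop 0] with c (hc : 0 < c)
  exact isPosSemidefFun_fourier (integrable_gaussian_mul (by positivity)
    (continuous_fourierInv hF).aestronglyMeasurable (norm_fourierInv_le F))
    fun x => mul_nonneg (by exact_mod_cast (Real.exp_pos _).le) (hpos x)

/-! ### Convolution with an integrable kernel -/

lemma fourierInv_mul_fourier {n : ℕ} {F f : Rn n → ℂ} (hF : Integrable F) (hf : Integrable f)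
    (x : Rn n) : 𝓕⁻ (fun y => F y * 𝓕 f y) x = ∫ z, 𝓕⁻ F z * f (x - z) := by
  have hFe : Integrable fun y => cexp (↑(2 * Real.pi * inner ℝ y x) * I) * F y :=
    hF.bdd_mul (c := 1) (Continuous.aestronglyMeasurable (by fun_prop))
      (Eventually.of_forall fun w => (Complex.norm_exp_ofReal_mul_I _).le)
  have h1 : ∫ y, 𝓕 f y • (cexp (↑(2 * Real.pi * inner ℝ y x) * I) * F y) =
      ∫ z, f z • 𝓕 (fun y => cexp (↑(2 * Real.pi * inner ℝ y x) * I) * F y) z := by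
    simpa using! (VectorFourier.integral_fourierIntegral_smul_eq_flip (L := innerₗ (Rn n))
      Real.continuous_fourierChar continuous_inner hf hFe)
  have h2 : ∀ z, 𝓕 (fun y => cexp (↑(2 * Real.pi * inner ℝ y x) * I) * F y) z =
      𝓕⁻ F (x - z) := by
    intro z
    rw [Real.fourier_eq', Real.fourierInv_eq']
    congr 1; ext y
    rw [smul_eq_mul, smul_eq_mul, ← mul_assoc, ← Complex.exp_add, inner_sub_right]
    congr 2
    push_cast; ring
  simp_rw [h2] at h1
  rw [Real.fourierInv_eq', ← integral_sub_left_eq_self (fun z => 𝓕⁻ F z * f (x - z)) volume x]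
  simp only [sub_sub_cancel]
  rw [show ∫ z, 𝓕⁻ F (x - z) * f z = ∫ z, f z • 𝓕⁻ F (x - z) by simp_rw [smul_eq_mul, mul_comm],
    ← h1]
  congr 1; ext y
  simp only [smul_eq_mul]; ring

/-- Young's inequality `‖K ⋆ f‖_p ≤ ‖K‖_1 ‖f‖_p`, from Jensen's inequality for the measure
`‖K z‖ dz`. -/
lemma eLpNorm_integral_mul_sub_le {n : ℕ} {K f : Rn n → ℂ} (hK : Continuous K) (hf : Continuous f)
    {p : ℝ≥0∞} (hp1 : 1 ≤ p) (hp : p ≠ ∞) :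
    eLpNorm (fun x => ∫ z, K z * f (x - z)) p volume ≤ (∫⁻ z, ‖K z‖ₑ) * eLpNorm f p volume := by
  have hp0 : p ≠ 0 := (zero_lt_one.trans_le hp1).ne'
  have hpr : 0 < p.toReal := ENNReal.toReal_pos hp0 hp
  have hpr1 : 1 ≤ p.toReal := by simpa using ENNReal.toReal_mono hp hp1
  set M := ∫⁻ z, ‖K z‖ₑ with hM
  have hfm := hf.measurable
  have hKm : Measurable fun z => ‖K z‖ₑ := hK.measurable.enorm
  set κ : Measure (Rn n) := volume.withDensity fun z => ‖K z‖ₑ with hκ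
  have hκu : κ Set.univ = M := by
    rw [hκ, withDensity_apply _ MeasurableSet.univ, Measure.restrict_univ]
  have hpt : ∀ x, ‖∫ z, K z * f (x - z)‖ₑ ^ p.toReal ≤
      (∫⁻ z, ‖f (x - z)‖ₑ ^ p.toReal ∂κ) * M ^ (p.toReal - 1) := by
    intro x
    have hfx : Continuous fun z => f (x - z) := by fun_prop
    have h1 : ‖∫ z, K z * f (x - z)‖ₑ ≤ eLpNorm (fun z => f (x - z)) 1 κ := by
      rw [eLpNorm_one_eq_lintegral_enorm, hκ,
        lintegral_withDensity_eq_lintegral_mul _ hKm (by fun_prop)]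
      refine (enorm_integral_le_lintegral_enorm _).trans_eq ?_
      simp [enorm_mul]
    have h2 := h1.trans (eLpNorm_le_eLpNorm_mul_rpow_measure_univ hp1
      hfx.aestronglyMeasurable)
    rw [eLpNorm_eq_lintegral_rpow_enorm_toReal hp0 hp, hκu] at h2
    have h3 := ENNReal.rpow_le_rpow h2 hpr.le
    rwa [ENNReal.mul_rpow_of_nonneg _ _ hpr.le, ← ENNReal.rpow_mul, ← ENNReal.rpow_mul,
      one_div_mul_cancel hpr.ne', ENNReal.rpow_one, sub_mul, one_div_mul_cancel hpr.ne',
      ENNReal.toReal_one, div_one, one_mul] at h3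
  rw [eLpNorm_eq_lintegral_rpow_enorm_toReal hp0 hp, eLpNorm_eq_lintegral_rpow_enorm_toReal hp0 hp]
  have hswap : ∫⁻ x, ∫⁻ z, ‖f (x - z)‖ₑ ^ p.toReal ∂κ = M * ∫⁻ x, ‖f x‖ₑ ^ p.toReal := by
    rw [lintegral_lintegral_swap (Measurable.aemeasurable (by fun_prop))]
    simp_rw [lintegral_sub_right_eq_self (fun x => ‖f x‖ₑ ^ p.toReal)]
    rw [lintegral_const, hκu, mul_comm]
  have hmain : ∫⁻ x, ‖∫ z, K z * f (x - z)‖ₑ ^ p.toReal ≤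
      M ^ p.toReal * ∫⁻ x, ‖f x‖ₑ ^ p.toReal := by
    refine (lintegral_mono hpt).trans_eq ?_
    rw [lintegral_mul_const _ (Measurable.lintegral_prod_right' (ν := κ)
      (f := fun z : Rn n × Rn n => ‖f (z.1 - z.2)‖ₑ ^ p.toReal) (by fun_prop)), hswap,
      mul_right_comm]
    congr 1
    nth_rw 1 [← ENNReal.rpow_one M]
    rw [← ENNReal.rpow_add_of_nonneg _ _ zero_le_one (by linarith)]
    congr 1; ring
  refine (ENNReal.rpow_le_rpow hmain (by positivity)).trans_eq ?_
  rw [ENNReal.mul_rpow_of_nonneg _ _ (by positivity), ← ENNReal.rpow_mul,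
    mul_one_div_cancel hpr.ne', ENNReal.rpow_one]

/-! ### Scalar Fourier multipliers with positive semidefinite symbol -/

lemma tendsto_fourierInv_gaussian_mul {n : ℕ} {H : Rn n → ℂ} (hH : Integrable H) (x : Rn n) :
    Tendsto (fun N : ℕ => 𝓕⁻ (fun y : Rn n => (Real.exp (-((N : ℝ) + 1)⁻¹ * ‖y‖ ^ 2) : ℂ) * H y) x)
      atTop (𝓝 (𝓕⁻ H x)) := by
  have hHe : Integrable fun y => cexp (↑(2 * Real.pi * inner ℝ y x) * I) * H y :=
    hH.bdd_mul (c := 1) (Continuous.aestronglyMeasurable (by fun_prop))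
      (Eventually.of_forall fun w => (Complex.norm_exp_ofReal_mul_I _).le)
  have h1 := (Real.tendsto_integral_cexp_sq_smul hHe).comp
    (tendsto_atTop_add_const_right _ (1 : ℝ) tendsto_natCast_atTop_atTop)
  simp_rw [Real.fourierInv_eq']
  refine h1.congr fun N => ?_
  simp only [Function.comp_apply]
  congr 1; ext y
  simp only [smul_eq_mul]
  push_cast; ring

section Sufficiency

variable {n : ℕ} {g f : Rn n → ℂ} {C : ℝ}

lemma integrable_mul_fourier (hgc : Continuous g) (hgC : ∀ x, ‖g x‖ ≤ C)
    (hFf : Integrable (𝓕 f)) : Integrable fun y => g y * 𝓕 f y :=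
  hFf.bdd_mul hgc.aestronglyMeasurable (Eventually.of_forall hgC)

/-- The damped multiplier is convolution with the inverse Fourier transform of the damped symbol. -/
lemma fourierInv_gaussian_mul_mul_fourier (hgc : Continuous g) (hgC : ∀ x, ‖g x‖ ≤ C)
    (hf : Integrable f) {ε : ℝ} (hε : 0 < ε) (x : Rn n) :
    𝓕⁻ (fun y : Rn n => (Real.exp (-ε * ‖y‖ ^ 2) : ℂ) * (g y * 𝓕 f y)) x =
      ∫ z, 𝓕⁻ (fun y : Rn n => (Real.exp (-ε * ‖y‖ ^ 2) : ℂ) * g y) z * f (x - z) := by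
  rw [← fourierInv_mul_fourier (integrable_gaussian_mul hε hgc.aestronglyMeasurable hgC) hf]
  simp_rw [mul_assoc]

lemma IsPosSemidefFun.fourierInv_mul_fourier_nonneg (hg : IsPosSemidefFun g) (hgc : Continuous g)
    (hgC : ∀ x, ‖g x‖ ≤ C) (hf : Integrable f) (hFf : Integrable (𝓕 f)) (hpos : ∀ x, 0 ≤ f x)
    (x : Rn n) : 0 ≤ 𝓕⁻ (fun y => g y * 𝓕 f y) x := by
  refine ge_of_tendsto (tendsto_fourierInv_gaussian_mul (integrable_mul_fourier hgc hgC hFf) x)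
    (Eventually.of_forall fun N => ?_)
  rw [fourierInv_gaussian_mul_mul_fourier hgc hgC hf (by positivity)]
  exact integral_nonneg fun z => mul_nonneg
    (hg.fourierInv_gaussian_mul_nonneg hgc hgC (by positivity) z) (hpos _)

/-- The `L^p` bound does not depend on the Gaussian damping, since each damped kernel has mass at
most `‖g 0‖`; Fatou's lemma removes the damping. -/
lemma IsPosSemidefFun.eLpNorm_fourierInv_mul_fourier_le (hg : IsPosSemidefFun g)
    (hgc : Continuous g) (hgC : ∀ x, ‖g x‖ ≤ C) (hfc : Continuous f) (hf : Integrable f)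
    (hFf : Integrable (𝓕 f)) {p : ℝ≥0∞} (hp1 : 1 ≤ p) (hp : p ≠ ∞) :
    eLpNorm (𝓕⁻ fun y => g y * 𝓕 f y) p volume ≤ ‖g 0‖ₑ * eLpNorm f p volume := by
  have hH := integrable_mul_fourier hgc hgC hFf
  refine (Lp.eLpNorm_lim_le_liminf_eLpNorm (p := p) (μ := volume)
    (fun N => ?_) _ (Eventually.of_forall fun x => tendsto_fourierInv_gaussian_mul hH x)).trans ?_
  · refine (continuous_fourierInv ?_).aestronglyMeasurable
    refine hH.bdd_mul (c := 1) (Continuous.aestronglyMeasurable (by fun_prop))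
      (Eventually.of_forall fun y => ?_)
    rw [Complex.norm_real, Real.norm_of_nonneg (Real.exp_pos _).le, Real.exp_le_one_iff]
    have : 0 ≤ ((N : ℝ) + 1)⁻¹ * ‖y‖ ^ 2 := by positivity
    linarith
  · refine (liminf_le_liminf (Eventually.of_forall fun N => ?_)).trans_eq (liminf_const _)
    have hε : (0 : ℝ) < ((N : ℝ) + 1)⁻¹ := by positivity
    have hi := integrable_gaussian_mul hε hgc.aestronglyMeasurable hgC
    rw [funext (fourierInv_gaussian_mul_mul_fourier hgc hgC hf hε)]
    refine (eLpNorm_integral_mul_sub_le (continuous_fourierInv hi) hfc hp1 hp).trans ?_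
    gcongr
    refine (lintegral_enorm_fourierInv_le hi (Continuous.continuousAt (by fun_prop))
      (hg.fourierInv_gaussian_mul_nonneg hgc hgC hε)).trans_eq ?_
    simp

end Sufficiency

/-! ### Density of test functions -/

/-- Test functions are dense in `L^p`, and nonnegative test functions are dense in its positive
cone. For the second claim, `√u ∈ L^{2p}` is approximated by real test functions `φ`, and `φ²`
approximates `u` in `L^p` by Hölder's inequality. -/
lemma exists_test_tendsto_eLpNorm_sub {n : ℕ} {p : ℝ≥0∞} [Fact (1 ≤ p)] (hp : p ≠ ∞)
    (u : Lp ℂ p (volume : Measure (Rn n))) :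
    ∃ φ : ℕ → Test n, Tendsto (fun i => eLpNorm (fun x => u x - φ i x) p volume) atTop (𝓝 0) ∧
      ((∀ᵐ x, 0 ≤ u x) → ∀ i x, 0 ≤ φ i x) := by
  have hp1 : 1 ≤ p := Fact.out
  have hp0 : p ≠ 0 := (zero_lt_one.trans_le hp1).ne'
  have hδ : Tendsto (fun i : ℕ => ENNReal.ofReal (1 / ((i : ℝ) + 1))) atTop (𝓝 0) := by
    simpa using! ENNReal.tendsto_ofReal tendsto_one_div_add_atTop_nhds_zero_nat
  have hδ0 : ∀ i : ℕ, (0 : ℝ) < 1 / ((i : ℝ) + 1) := fun i => by positivity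
  by_cases hu : ∀ᵐ x, 0 ≤ u x
  · set r : ℝ≥0∞ := p / 2⁻¹ with hr
    have hrtop : r ≠ ∞ := by simp [hr, div_eq_mul_inv, ENNReal.mul_eq_top, hp]
    have hr1 : 1 ≤ r := hp1.trans (by
      rw [hr, div_eq_mul_inv, inv_inv]; exact le_mul_of_one_le_right' (by norm_num))
    have : r.HolderTriple r p := ⟨by
      rw [hr, div_eq_mul_inv, inv_inv, ENNReal.mul_inv (Or.inl hp0) (Or.inl hp), ← mul_add,
        ENNReal.inv_two_add_inv_two, mul_one]⟩
    -- `w` is `√u`, and `r` is `2p`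
    set w : Rn n → ℝ := fun x => ‖u x‖ ^ (2⁻¹ : ℝ≥0∞).toReal with hw
    have hwL : MemLp w r volume := (Lp.memLp u).norm_rpow_div _
    choose φ hφc hφs hφ using fun i : ℕ => hwL.exist_eLpNorm_sub_le hrtop hr1 (hδ0 i)
    have hw2 : ∀ x, w x * w x = ‖u x‖ := fun x => by
      simp only [hw]
      rw [← Real.rpow_add' (norm_nonneg _) (by norm_num)]
      norm_num
    refine ⟨fun i => ⟨fun x => ((φ i x * φ i x : ℝ) : ℂ), ?_, ?_, by simp⟩, ?_, fun _ i x => ?_⟩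
    · have := hφs i
      exact Complex.ofRealCLM.contDiff.comp (this.mul this)
    · exact ((hφc i).mul_right (f' := φ i)).comp_left (g := fun t : ℝ => (t : ℂ)) (by simp)
    · have hbd : ∀ i, eLpNorm (fun x => u x - ((φ i x * φ i x : ℝ) : ℂ)) p volume ≤
          ENNReal.ofReal (1 / ((i : ℝ) + 1)) * (2 * eLpNorm w r volume + 1) := by
        intro i
        have hφm : AEStronglyMeasurable (φ i) volume := (hφs i).continuous.aestronglyMeasurable
        have h1 : eLpNorm (fun x => u x - ((φ i x * φ i x : ℝ) : ℂ)) p volume =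
            eLpNorm ((w - φ i) • (w + φ i)) p volume := by
          refine eLpNorm_congr_norm_ae ?_
          filter_upwards [hu] with x hx
          have h2 : u x = ((w x * w x : ℝ) : ℂ) := by
            rw [hw2]; exact (Complex.norm_of_nonneg' hx).symm
          rw [h2, ← Complex.ofReal_sub, Complex.norm_real]
          congr 1
          simp only [Pi.smul_apply', Pi.sub_apply, Pi.add_apply, smul_eq_mul]
          ring
        rw [h1]
        refine (eLpNorm_smul_le_mul_eLpNorm (p := r) (q := r) (hwL.1.add hφm)
          (hwL.1.sub hφm)).trans ?_
        gcongr
        · exact hφ i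
        · have h3 : w + φ i = (2 : ℝ) • w - (w - φ i) := by
            ext x; simp; ring
          rw [h3]
          refine (eLpNorm_sub_le (hwL.1.const_smul _) (hwL.1.sub hφm) hr1).trans ?_
          gcongr
          · rw [eLpNorm_const_smul]; simp [enorm]
          · refine (hφ i).trans ?_
            rw [ENNReal.ofReal_le_one, div_le_one (by positivity)]
            linarith [(Nat.cast_nonneg i : (0 : ℝ) ≤ i)]
      refine tendsto_of_tendsto_of_tendsto_of_le_of_le tendsto_const_nhds ?_
        (fun _ => zero_le) hbd
      have := ENNReal.Tendsto.mul_const (b := 2 * eLpNorm w r volume + 1) hδ (Or.inr (by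
        simp [ENNReal.mul_eq_top, hwL.eLpNorm_ne_top]))
      rwa [zero_mul] at this
    · change (0 : ℂ) ≤ ((φ i x * φ i x : ℝ) : ℂ)
      exact_mod_cast mul_self_nonneg (φ i x)
  · choose φ hφc hφs hφ using fun i : ℕ => (Lp.memLp u).exist_eLpNorm_sub_le hp hp1 (hδ0 i)
    exact ⟨fun i => ⟨φ i, hφs i, hφc i, by simp⟩,
      tendsto_of_tendsto_of_tendsto_of_le_of_le tendsto_const_nhds hδ (fun _ => zero_le) hφ,
      fun h => absurd h hu⟩

/-! ### The matrix-valued multiplier -/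

lemma integral_eq_smul_integral_comp_two_pi {n : ℕ} (H : Rn n → ℂ) :
    ∫ y, H y = (((2 * Real.pi) ^ n : ℝ) : ℂ) * ∫ y, H ((2 * Real.pi) • y) := by
  have h := Measure.integral_comp_smul (volume : Measure (Rn n)) H (2 * Real.pi)
  have h2 : (0 : ℝ) < (2 * Real.pi) ^ n := by positivity
  rw [h, finrank_euclideanSpace_fin, abs_of_pos (inv_pos.2 h2), Complex.real_smul, ← mul_assoc,
    ← Complex.ofReal_mul, mul_inv_cancel₀ h2.ne', Complex.ofReal_one, one_mul]

/-- The multiplier in terms of Mathlib's Fourier transform: rescaling the frequency variable by `2π`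
absorbs both normalizing factors `(2π)^{-n/2}`. -/
lemma check_mul_hat {n : ℕ} (g f : Rn n → ℂ) (x : Rn n) :
    check (fun y => g y * hat f y) x =
      𝓕⁻ (fun y => g ((2 * Real.pi) • y) * 𝓕 f y) x := by
  rw [check, integral_eq_smul_integral_comp_two_pi, Real.fourierInv_eq', ← mul_assoc,
    ← integral_const_mul]
  congr 1; ext y
  have hpi : (2 * Real.pi) ≠ 0 := by positivity
  rw [hat_eq, smul_smul, inv_mul_cancel₀ hpi, one_smul, smul_eq_mul, inner_smul_right,
    real_inner_comm y x]
  have hc : (((2 * Real.pi) ^ (-(n : ℝ) / 2) : ℝ) : ℂ) * (((2 * Real.pi) ^ n : ℝ) : ℂ) *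
      (((2 * Real.pi) ^ (-(n : ℝ) / 2) : ℝ) : ℂ) = 1 := by
    rw [← Complex.ofReal_mul, ← Complex.ofReal_mul, ← Real.rpow_natCast,
      ← Real.rpow_add (by positivity), ← Real.rpow_add (by positivity)]
    norm_num
    ring_nf
    simp
  calc _ = ((((2 * Real.pi) ^ (-(n : ℝ) / 2) : ℝ) : ℂ) * (((2 * Real.pi) ^ n : ℝ) : ℂ) *
      (((2 * Real.pi) ^ (-(n : ℝ) / 2) : ℝ) : ℂ)) * (cexp (I * ↑(2 * Real.pi * inner ℝ y x)) *
        (g ((2 * Real.pi) • y) * 𝓕 f y)) := by ring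
    _ = _ := by rw [hc, one_mul, mul_comm I]

lemma isPosSemidefFun_comp_smul {n : ℕ} {F : Rn n → ℂ} (hF : IsPosSemidefFun F) (a : ℝ) :
    IsPosSemidefFun fun x => F (a • x) := by
  intro N x
  simpa only [smul_sub] using hF N fun p => a • x p

lemma test_memLp {n : ℕ} (p : ℝ≥0∞) (f : Test n) : MemLp (f : Rn n → ℂ) p volume :=
  f.continuous.memLp_of_hasCompactSupport f.hasCompactSupport

lemma fourier_test_integrable {n : ℕ} (f : Test n) : Integrable (𝓕 (f : Rn n → ℂ)) := by
  have := (𝓕 (f.hasCompactSupport.toSchwartzMap f.contDiff)).integrable (μ := volume)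
  exact this

section Multiplier

variable {n m : ℕ} {G : Rn n → Matrix (Fin m) (Fin m) ℂ} (hc : Continuous G)
  (hb : ∃ C : ℝ, ∀ x j k, ‖G x j k‖ ≤ C)

lemma multiplier_apply (f : Fin m → Test n) (j : Fin m) (x : Rn n) :
    multiplier G hc hb f j x =
      ∑ k, 𝓕⁻ (fun y => G ((2 * Real.pi) • y) j k * 𝓕 (f k : Rn n → ℂ) y) x := by
  obtain ⟨C, hC⟩ := hb
  change check (symbolMul G f j) x = _
  simp_rw [← fun k => check_mul_hat (fun y => G y j k) (f k) x]
  simp only [check, symbolMul, Matrix.mulVec, dotProduct, Finset.mul_sum]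
  rw [integral_finsetSum _ fun k _ => ?_, Finset.mul_sum]
  have h1 : Integrable fun y => G y j k * hat (f k) y :=
    (hat_test_integrable (f k)).bdd_mul (c := C) (hc.matrix_elem j k).aestronglyMeasurable
      (Eventually.of_forall fun x => hC x j k)
  refine h1.bdd_mul (c := 1) (Continuous.aestronglyMeasurable (by fun_prop))
    (Eventually.of_forall fun y => ?_)
  rw [mul_comm]
  exact (Complex.norm_exp_ofReal_mul_I _).le

lemma exists_test_tendsto {p : ℝ≥0∞} [Fact (1 ≤ p)] (hp : p ≠ ∞) (u : LpVec n m p) :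
    ∃ φ : ℕ → Fin m → Test n, Tendsto (fun i => testToLp p (φ i)) atTop (𝓝 u) ∧
      (IsNonneg u → ∀ i k x, 0 ≤ φ i k x) := by
  choose φ hφ hφ0 using fun k => exists_test_tendsto_eLpNorm_sub hp (u k)
  refine ⟨fun i k => φ k i, ?_, fun hu i k x => hφ0 k (hu k) i x⟩
  have h1 : Tendsto (fun i => WithLp.ofLp (testToLp p fun k => φ k i)) atTop
      (𝓝 (WithLp.ofLp u)) := by
    rw [tendsto_pi_nhds]
    intro k
    rw [Lp.tendsto_Lp_iff_tendsto_eLpNorm']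
    refine (hφ k).congr fun i => ?_
    rw [← eLpNorm_neg]
    refine eLpNorm_congr_ae ?_
    filter_upwards [(test_memLp p (φ k i)).coeFn_toLp] with x hx
    simp only [Pi.neg_apply, Pi.sub_apply, neg_sub, testToLp]
    rw [hx]
  exact ((PiLp.continuous_toLp 1 _).tendsto _).comp h1

lemma isNonneg_of_tendsto {p : ℝ≥0∞} [Fact (1 ≤ p)] {u : ℕ → LpVec n m p} {v : LpVec n m p}
    (hu : ∀ i, IsNonneg (u i)) (hlim : Tendsto u atTop (𝓝 v)) : IsNonneg v := by
  intro k
  have h1 : Tendsto (fun i => u i k) atTop (𝓝 (v k)) :=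
    ((PiLp.continuous_apply 1 _ k).tendsto v).comp hlim
  obtain ⟨ns, -, hns⟩ := (tendstoInMeasure_of_tendsto_Lp h1).exists_seq_tendsto_ae
  filter_upwards [hns, ae_all_iff.2 fun i => hu i k] with x hx h0
  exact ge_of_tendsto hx (Eventually.of_forall fun i => h0 (ns i))

/-- The inclusion `testToLp` as a linear map. -/
noncomputable def testToLpₗ (n m : ℕ) (p : ℝ≥0∞) : (Fin m → Test n) →ₗ[ℂ] LpVec n m p where
  toFun := testToLp p
  map_add' f g := by
    refine PiLp.ext fun k => ?_
    exact MemLp.toLp_add (test_memLp p (f k)) (test_memLp p (g k))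
  map_smul' c f := by
    refine PiLp.ext fun k => ?_
    exact MemLp.toLp_const_smul c (test_memLp p (f k))

lemma denseRange_testToLp {p : ℝ≥0∞} [Fact (1 ≤ p)] (hp : p ≠ ∞) :
    DenseRange (testToLpₗ n m p) := fun u => by
  obtain ⟨φ, hφ, -⟩ := exists_test_tendsto hp u
  exact mem_closure_of_tendsto hφ (Eventually.of_forall fun i => ⟨φ i, rfl⟩)

lemma multiplier_nonneg (hG : ∀ j k, IsPosSemidefFun fun x => G x j k) {f : Fin m → Test n}
    (hf : ∀ k x, 0 ≤ f k x) (j : Fin m) (x : Rn n) : 0 ≤ multiplier G hc hb f j x := by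
  obtain ⟨C, hC⟩ := id hb
  rw [multiplier_apply]
  refine Finset.sum_nonneg fun k _ => ?_
  exact (isPosSemidefFun_comp_smul (hG j k) _).fourierInv_mul_fourier_nonneg
    ((hc.matrix_elem j k).comp (continuous_const_smul _)) (fun y => hC _ j k)
    (test_integrable _) (fourier_test_integrable _) (hf k) x

lemma eLpNorm_multiplier_le (hG : ∀ j k, IsPosSemidefFun fun x => G x j k)
    {p : ℝ≥0∞} (hp1 : 1 ≤ p) (hp : p ≠ ∞) (f : Fin m → Test n) (j : Fin m) :
    eLpNorm (multiplier G hc hb f j) p volume ≤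
      ∑ k, ‖G 0 j k‖ₑ * eLpNorm (f k : Rn n → ℂ) p volume := by
  obtain ⟨C, hC⟩ := id hb
  have hGc : ∀ k, Continuous fun y => G ((2 * Real.pi) • y) j k := fun k =>
    (hc.matrix_elem j k).comp (continuous_const_smul _)
  have hGC : ∀ k y, ‖G ((2 * Real.pi) • y) j k‖ ≤ C := fun k y => hC _ _ _
  have hAeq : (multiplier G hc hb f j : Rn n → ℂ) =
      ∑ k, 𝓕⁻ (fun y => G ((2 * Real.pi) • y) j k * 𝓕 (f k : Rn n → ℂ) y) := by
    ext x
    rw [Finset.sum_apply]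
    exact multiplier_apply hc hb f j x
  rw [hAeq]
  refine (eLpNorm_sum_le (fun k _ => (continuous_fourierInv (integrable_mul_fourier (hGc k)
    (hGC k) (fourier_test_integrable (f k)))).aestronglyMeasurable) hp1).trans ?_
  refine Finset.sum_le_sum fun k _ => ?_
  have h := (isPosSemidefFun_comp_smul (hG j k) (2 * Real.pi)).eLpNorm_fourierInv_mul_fourier_le
    (hGc k) (hGC k) (f k).continuous (test_integrable (f k)) (fourier_test_integrable (f k)) hp1 hp
  rwa [smul_zero] at h

/-- A linear operator from test functions to `C_∞` whose values lie in `L^p`, regarded as a map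
into `L^p`. -/
noncomputable def toLpₗ (A : (Fin m → Test n) →ₗ[ℂ] (Fin m → CInfty n)) (p : ℝ≥0∞)
    (hA : ∀ f j, MemLp (A f j) p (volume : Measure (Rn n))) :
    (Fin m → Test n) →ₗ[ℂ] LpVec n m p where
  toFun f := WithLp.toLp 1 fun j => (hA f j).toLp (A f j)
  map_add' f g := by
    refine PiLp.ext fun k => Eq.trans ?_ (MemLp.toLp_add (hA f k) (hA g k))
    simp only [map_add]
    rfl
  map_smul' c f := by
    refine PiLp.ext fun k => Eq.trans ?_ (MemLp.toLp_const_smul c (hA f k))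
    simp only [map_smul]
    rfl

theorem extendsToPositive_of_isPosSemidefFun (hG : ∀ j k, IsPosSemidefFun fun x => G x j k)
    {p : ℝ≥0∞} [Fact (1 ≤ p)] (hp : p ≠ ∞) : ExtendsToPositive (multiplier G hc hb) p := by
  have hp1 : 1 ≤ p := Fact.out
  have hbd := fun f j => eLpNorm_multiplier_le hc hb hG hp1 hp f j
  have hpos := fun f hf j x => multiplier_nonneg hc hb hG (f := f) hf j x
  generalize multiplier G hc hb = A at *
  have hfin : ∀ (f : Fin m → Test n) j k,
      ‖G 0 j k‖ₑ * eLpNorm (f k : Rn n → ℂ) p volume < ∞ := fun f j k =>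
    ENNReal.mul_lt_top (by simp) (test_memLp p (f k)).eLpNorm_lt_top
  have hmem : ∀ f j, MemLp (A f j) p volume := fun f j =>
    ⟨(A f j).continuous.aestronglyMeasurable,
      (hbd f j).trans_lt (ENNReal.sum_lt_top.2 fun k _ => hfin f j k)⟩
  set L := toLpₗ A p hmem with hL
  have hnorm : ∀ f, ‖L f‖ ≤ (∑ j, ∑ k, ‖G 0 j k‖) * ‖testToLpₗ n m p f‖ := by
    intro f
    rw [PiLp.norm_eq_of_L1, Finset.sum_mul]
    refine Finset.sum_le_sum fun j _ => ?_
    rw [Finset.sum_mul]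
    calc ‖L f j‖ = (eLpNorm (A f j) p volume).toReal := Lp.norm_toLp _ (hmem f j)
      _ ≤ (∑ k, ‖G 0 j k‖ₑ * eLpNorm (f k : Rn n → ℂ) p volume).toReal :=
          ENNReal.toReal_mono (ENNReal.sum_lt_top.2 fun k _ => hfin f j k).ne (hbd f j)
      _ = ∑ k, ‖G 0 j k‖ * (eLpNorm (f k : Rn n → ℂ) p volume).toReal := by
          rw [ENNReal.toReal_sum fun k _ => (hfin f j k).ne]
          simp [ENNReal.toReal_mul]
      _ ≤ _ := by
          refine Finset.sum_le_sum fun k _ => ?_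
          gcongr
          refine le_trans (le_of_eq ?_) (PiLp.norm_apply_le (testToLpₗ n m p f) k)
          exact (Lp.norm_toLp _ (test_memLp p (f k))).symm
  have hd := denseRange_testToLp (n := n) (m := m) hp
  have hT : ∀ f, L.extendOfNorm (testToLpₗ n m p) (testToLp p f) = L f := fun f =>
    LinearMap.extendOfNorm_eq hd ⟨_, hnorm⟩ f
  refine ⟨L.extendOfNorm (testToLpₗ n m p), fun f j => ?_, fun u hu => ?_⟩
  · rw [hT]
    exact (hmem f j).coeFn_toLp
  · obtain ⟨φ, hφ, hφ0⟩ := exists_test_tendsto hp u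
    refine isNonneg_of_tendsto (fun i j => ?_)
      (((L.extendOfNorm (testToLpₗ n m p)).continuous.tendsto u).comp hφ)
    simp only [Function.comp_apply, hT]
    filter_upwards [(hmem (φ i) j).coeFn_toLp] with x hx
    exact le_of_le_of_eq (hpos (φ i) (hφ0 hu i) j x) hx.symm

/-! ### Necessity of positive semidefiniteness -/

lemma multiplier_nonneg_of_extendsToPositive {p : ℝ≥0∞} [Fact (1 ≤ p)]
    (h : ExtendsToPositive (multiplier G hc hb) p) {f : Fin m → Test n}
    (hf : ∀ k x, 0 ≤ f k x) (j : Fin m) (x : Rn n) : 0 ≤ multiplier G hc hb f j x := by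
  obtain ⟨T, hT, hpos⟩ := h
  have h1 : IsNonneg (testToLp p f) := fun k => by
    filter_upwards [(test_memLp p (f k)).coeFn_toLp] with x hx
    exact le_of_le_of_eq (hf k x) hx.symm
  have h2 : ∀ᵐ x, 0 ≤ multiplier G hc hb f j x := by
    filter_upwards [hpos _ h1 j, hT f j] with x hx hx'
    rwa [← hx']
  have hopen : IsOpen {x | ¬ 0 ≤ multiplier G hc hb f j x} :=
    (isClosed_le continuous_const (multiplier G hc hb f j).continuous).isOpen_compl
  have h3 := hopen.eq_empty_of_measure_zero (μ := volume) h2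
  by_contra hx
  exact (Set.eq_empty_iff_forall_notMem.1 h3 x) hx

/-- An approximate identity of nonnegative test functions; its Fourier transforms tend to `1`. -/
lemma exists_test_fourier_tendsto_one (n : ℕ) :
    ∃ φ : ℕ → Test n, (∀ i x, 0 ≤ φ i x) ∧
      ∀ y, Tendsto (fun i => 𝓕 (φ i : Rn n → ℂ) y) atTop (𝓝 1) := by
  let b : ℕ → ContDiffBump (0 : Rn n) := fun i =>
    ⟨1 / ((i : ℝ) + 1) / 2, 1 / ((i : ℝ) + 1), by positivity, half_lt_self (by positivity)⟩
  refine ⟨fun i => ⟨fun x => (((b i).normed volume x : ℝ) : ℂ),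
    Complex.ofRealCLM.contDiff.comp (b i).contDiff_normed,
    (b i).hasCompactSupport_normed.comp_left (g := fun t : ℝ => (t : ℂ)) (by simp), by simp⟩,
    fun i x => ?_, fun y => ?_⟩
  · change (0 : ℂ) ≤ (((b i).normed volume x : ℝ) : ℂ)
    exact_mod_cast (b i).nonneg_normed x
  · have hb0 : Tendsto (fun i => (b i).rOut) atTop (𝓝 0) :=
      tendsto_one_div_add_atTop_nhds_zero_nat
    have h1 := ContDiffBump.convolution_tendsto_right_of_continuous (μ := volume) hb0
      (g := fun t : Rn n => cexp (↑(2 * Real.pi * inner ℝ t y) * I)) (by fun_prop) 0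
    simp only [inner_zero_left, mul_zero, Complex.ofReal_zero, zero_mul, Complex.exp_zero] at h1
    refine h1.congr fun i => ?_
    rw [convolution_def, Real.fourier_eq']
    congr 1; ext t
    simp only [ContinuousLinearMap.lsmul_apply, zero_sub, inner_neg_left,
      Complex.real_smul, smul_eq_mul]
    rw [mul_comm, show 2 * Real.pi * -inner ℝ t y = -2 * Real.pi * inner ℝ t y by ring]
    rfl

/-- Applied to a nonnegative test function `φ` in the `k`-th slot, the operator gives
`𝓕⁻ (G_{jk} 𝓕 φ) ≥ 0`, so that `G_{jk} 𝓕 φ` is positive semidefinite; then `φ` runs through an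
approximate identity. -/
theorem isPosSemidefFun_of_extendsToPositive {p : ℝ≥0∞} [Fact (1 ≤ p)]
    (h : ExtendsToPositive (multiplier G hc hb) p) (j k : Fin m) :
    IsPosSemidefFun fun x => G x j k := by
  obtain ⟨C, hC⟩ := id hb
  obtain ⟨φ, hφ0, hφ⟩ := exists_test_fourier_tendsto_one n
  have hGc : Continuous fun y => G ((2 * Real.pi) • y) j k :=
    (hc.matrix_elem j k).comp (continuous_const_smul _)
  have hFc : ∀ i, Continuous (𝓕 (φ i : Rn n → ℂ)) := fun i =>
    VectorFourier.fourierIntegral_continuous Real.continuous_fourierChar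
      (by exact continuous_inner) (test_integrable (φ i))
  have h1 : ∀ i, IsPosSemidefFun fun y => G ((2 * Real.pi) • y) j k * 𝓕 (φ i : Rn n → ℂ) y := by
    intro i
    refine isPosSemidefFun_of_fourierInv_nonneg (integrable_mul_fourier hGc (fun y => hC _ _ _)
      (fourier_test_integrable (φ i))) (hGc.mul (hFc i)) fun x => ?_
    have h2 := multiplier_nonneg_of_extendsToPositive hc hb h
      (f := Pi.single (M := fun _ => Test n) k (φ i))
      (fun l y => ?_) j x
    · rw [multiplier_apply, Finset.sum_eq_single k] at h2
      · simpa using h2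
      · intro l _ hl
        have h3 : 𝓕 ((0 : Test n) : Rn n → ℂ) = 0 := by
          ext y; simp [Real.fourier_eq']
        rw [Pi.single_eq_of_ne hl, h3]
        simp [Real.fourierInv_eq']
      · simp
    · rcases eq_or_ne l k with rfl | hl
      · simpa using hφ0 i y
      · rw [Pi.single_eq_of_ne hl]; exact le_rfl
  have h4 : IsPosSemidefFun fun y => G ((2 * Real.pi) • y) j k :=
    isPosSemidefFun_of_tendsto (Eventually.of_forall h1) fun y => by
      simpa using (hφ y).const_mul (G ((2 * Real.pi) • y) j k)
  have h5 := isPosSemidefFun_comp_smul h4 (2 * Real.pi)⁻¹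
  simpa only [smul_smul, mul_inv_cancel₀ Real.two_pi_pos.ne', one_smul] using h5

end Multiplier

end PosMultiplier

theorem theorem2p2 (m n : ℕ)
    (G : PosMultiplier.Rn n → Matrix (Fin m) (Fin m) ℂ) (hc : Continuous G)
    (hb : ∃ C : ℝ, ∀ x j k, ‖G x j k‖ ≤ C) :
    List.TFAE [
      ∀ j k, PosMultiplier.IsPosSemidefFun (fun x => G x j k),
      PosMultiplier.ExtendsToPositive (PosMultiplier.multiplier G hc hb) 1,
      ∃ (p : ℝ≥0∞) (_ : Fact (1 ≤ p)), 1 < p ∧ p < ∞ ∧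
        PosMultiplier.ExtendsToPositive (PosMultiplier.multiplier G hc hb) p,
      ∀ (p : ℝ≥0∞) [Fact (1 ≤ p)], 1 < p → p < ∞ →
        PosMultiplier.ExtendsToPositive (PosMultiplier.multiplier G hc hb) p] := by
  tfae_have 1 → 2 := fun h =>
    PosMultiplier.extendsToPositive_of_isPosSemidefFun hc hb h ENNReal.one_ne_top
  tfae_have 2 → 1 := fun h => PosMultiplier.isPosSemidefFun_of_extendsToPositive hc hb h
  tfae_have 1 → 4 := fun h p _ _ hp =>
    PosMultiplier.extendsToPositive_of_isPosSemidefFun hc hb h hp.ne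
  tfae_have 4 → 3 := fun h => by
    have : Fact ((1 : ℝ≥0∞) ≤ 2) := ⟨by norm_num⟩
    exact ⟨2, this, by norm_num, by norm_num, h 2 (by norm_num) (by norm_num)⟩
  tfae_have 3 → 1 := fun ⟨p, _, _, _, h⟩ =>
    PosMultiplier.isPosSemidefFun_of_extendsToPositive hc hb h
  tfae_finish
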